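/- There is a universal constant $C < 24$ such that the following holds. Let $G$ be a graph on $n \ge 1$ nodes (the communication graph), and let node $i$ hold $m_i \ge 0$ local functions. An update is either a communication along an edge $\{i,j\}$ of $G$, which has probability $p_{ij}\ge 0$, or a local computation at a node $i$ using its $j$-th local function, which has probability $p^{\rm comp}_{ij}\ge 0$; all these probabilities sum to $1$. A random schedule is a sequence of independent updates drawn from this law. Executing a schedule means that all nodes start at time $0$ and perform the updates they are involved in, in the order of the schedule: a local computation at $i$ involves only $i$, starts as soon as $i$ has finished its previous updates and takes time $1$; a communication along $\{i,j\}$ involves only $i$ and $j$, starts as soon as both have finished their previous updates and takes time $\tau \ge 0$. Let $T(t)$ be the time at which the last node has finished its part of the first $t$ updates, and let $$p^{\max}_{\rm comm} = n \max_i \sum_{j \in \mathcal N(i)} p_{ij},$$ where $\mathcal N(i)$ is the set of neighbors of $i$ in $G$. Assume that every node performs local computations with the same probability $\sum_j p^{\rm comp}_{ij} = p_{\rm comp}/n$, and that $p_{\rm comp} > p^{\max}_{\rm comm}$ or $\tau > 1$. Then $$\mathbb P\big(T(t) \ge \nu t\big) \to 0 \quad\text{as } t \to \infty, \qquad \nu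 = n^{-1} C \left(p_{\rm comp} + \tau\, p^{\max}_{\rm comm}\right).$$ -/

import Mathlib

open MeasureTheory ProbabilityTheory Filter Topology

/-- The updates on a network of `n` nodes with communication graph `G`, in which node `i` holds
`m i` local functions: a communication along an edge of `G`, or a local computation at node `i`
using its `j`-th function (a virtual edge of the augmented graph). -/
inductive Update {n : ℕ} (G : SimpleGraph (Fin n)) (m : Fin n → ℕ) : Type
  | comm (e : G.edgeSet) : Update G m
  | comp (i : Fin n) (j : Fin (m i)) : Update G m

/-- The (finite) set of updates carries the discrete σ-algebra. -/
instance {n : ℕ} (G : SimpleGraph (Fin n)) (m : Fin n → ℕ) : MeasurableSpace (Update G m) := ⊤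

section

variable {n : ℕ} {G : SimpleGraph (Fin n)} {m : Fin n → ℕ}

open Classical in
/-- Given the times `T k` at which the nodes become available, the times at which they become
available after the given update. A communication along `{k, l}` starts when both `k` and `l` are
available, lasts `τ` and occupies exactly these two nodes; a local computation at `k` starts when
`k` is available, lasts `1` and occupies `k` only. -/
noncomputable def Update.exec (τ : ℝ) (u : Update G m) (T : Fin n → ℝ) : Fin n → ℝ :=
  match u with
  | .comm e => fun i => if i ∈ (e : Sym2 (Fin n)) then (Sym2.map T e).sup + τ else T i
  | .comp k _ => fun i => if i = k then T i + 1 else T i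

/-- `nodeTime τ σ t i` is the time at which node `i` is done with its part of the first `t`
updates of the schedule `σ`, all nodes starting at time `0`. -/
noncomputable def nodeTime (τ : ℝ) (σ : ℕ → Update G m) : ℕ → Fin n → ℝ
  | 0 => fun _ => 0
  | t + 1 => (σ t).exec τ (nodeTime τ σ t)

/-- The time `T(t)` needed to execute the first `t` updates of the schedule `σ`: the time at which
the last node is done. -/
noncomputable def execTime (τ : ℝ) (σ : ℕ → Update G m) (t : ℕ) : ℝ :=
  ⨆ i, nodeTime τ σ t i

/-- The probability `∑_{j ∈ V_i} p_{ij}` that a given update is a local computation at `i`. -/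
noncomputable def nodeCompProb (p : PMF (Update G m)) (i : Fin n) : ℝ :=
  ∑ j : Fin (m i), (p (.comp i j)).toReal

open Classical in
/-- The probability `∑_{j ∈ N(i)} p_{ij}` that a given update is a communication involving `i`. -/
noncomputable def nodeCommProb (p : PMF (Update G m)) (i : Fin n) : ℝ :=
  ∑ j : G.neighborSet i, (p (.comm ⟨s(i, (j : Fin n)), j.2⟩)).toReal

/-- `p^max_comm = n max_i ∑_{j ∈ N(i)} p_{ij}`. -/
noncomputable def pMaxComm (p : PMF (Update G m)) : ℝ :=
  n * ⨆ i, nodeCommProb p i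

end

section

variable {n : ℕ} {G : SimpleGraph (Fin n)} {m : Fin n → ℕ}

/-! Exponential-moment (Chernoff) argument on `Φ = ∑ i, exp (θ T i)`. A computation at `k`
multiplies the `k`-th term by `exp θ`. For a communication, the exponential of a maximum is at most
the sum of the two exponentials, so the growth can be charged linearly to the two endpoints, each
with relative growth `2 exp (θ τ) - 1` (`expPotential_exec_le`). With `q` the common computation
probability of a node and `r` a bound on its communication probability, averaging over an
independent update gives `E Φ ≤ n (1 + c) ^ t`, where `c = (2 exp (θ τ) - 1) r + (exp θ - 1) q`.
Since `Φ` dominates `exp (θ T(t))`, Markov's inequality bounds the probability by `n exp ((c - θ ν)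
t)`. It remains to find `θ` with `c < θ ν`: `exists_exponent` does so for `C = 5`, taking `θ = 1 /
τ` if `τ > 1` and `θ = 1` otherwise. -/

/-- An update is an edge of `G` or a local function of some node. -/
def updateEquiv : Update G m ≃ G.edgeSet ⊕ (Σ i, Fin (m i)) where
  toFun
    | .comm e => .inl e
    | .comp i j => .inr ⟨i, j⟩
  invFun
    | .inl e => .comm e
    | .inr x => .comp x.1 x.2
  left_inv u := by cases u <;> rfl
  right_inv x := by rcases x with e | ⟨i, j⟩ <;> rfl

open Classical in
noncomputable instance : Fintype (Update G m) := Fintype.ofEquiv _ updateEquiv.symm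

instance : DiscreteMeasurableSpace (Update G m) := ⟨fun _ => trivial⟩

open Classical in
theorem sum_update (f : Update G m → ℝ) :
    ∑ u, f u = ∑ e : G.edgeSet, f (.comm e) + ∑ i, ∑ j : Fin (m i), f (.comp i j) := by
  rw [← updateEquiv.symm.sum_comp f, Fintype.sum_sum_type, Fintype.sum_sigma]
  rfl

open Classical in
theorem sum_ite_mem_pair {k l : Fin n} (hkl : k ≠ l) (f : Fin n → ℝ) :
    ∑ i, (if i ∈ s(k, l) then f i else 0) = f k + f l := by
  rw [← Finset.sum_pair hkl, ← Finset.sum_filter]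
  congr 1
  ext i
  simp [Sym2.mem_iff]

/-! ### Growth of the potential under one update -/

/-- The exponential potential `∑ i, exp (θ T i)` of a vector of availability times. -/
noncomputable def expPotential (θ : ℝ) (T : Fin n → ℝ) : ℝ := ∑ i, Real.exp (θ * T i)

theorem expPotential_nonneg (θ : ℝ) (T : Fin n → ℝ) : 0 ≤ expPotential θ T :=
  Finset.sum_nonneg fun _ _ => (Real.exp_pos _).le

open Classical in
/-- An upper bound for the relative growth of the contribution of node `i` to the exponential
potential caused by the update `u`. -/
noncomputable def Update.growth (θ τ : ℝ) (u : Update G m) (i : Fin n) : ℝ :=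
  match u with
  | .comm e => if i ∈ (e : Sym2 (Fin n)) then 2 * Real.exp (θ * τ) - 1 else 0
  | .comp k _ => if i = k then Real.exp θ - 1 else 0

theorem expPotential_exec_le (θ τ : ℝ) (u : Update G m) (T : Fin n → ℝ) :
    expPotential θ (u.exec τ T) ≤ ∑ i, (1 + u.growth θ τ i) * Real.exp (θ * T i) := by
  classical
  cases u with
  | comp k j =>
    refine Finset.sum_le_sum fun i _ => le_of_eq ?_
    simp only [Update.exec, Update.growth]
    split_ifs
    · rw [mul_add, mul_one, Real.exp_add]; ring
    · ring
  | comm e =>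
    obtain ⟨e, he⟩ := e
    induction e with
    | _ k l =>
      have hkl : k ≠ l := G.ne_of_adj he
      set M := Real.exp (θ * τ) * (Real.exp (θ * T k) + Real.exp (θ * T l)) with hM
      have hmax : Real.exp (θ * ((T k ⊔ T l) + τ)) ≤ M := by
        rw [mul_add, Real.exp_add, mul_comm, hM]
        gcongr
        rcases max_choice (T k) (T l) with h | h <;> rw [h]
        · exact le_add_of_nonneg_right (Real.exp_pos _).le
        · exact le_add_of_nonneg_left (Real.exp_pos _).le
      calc expPotential θ _
          ≤ ∑ i, (Real.exp (θ * T i) +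
              (if i ∈ s(k, l) then M - Real.exp (θ * T i) else 0)) := by
            refine Finset.sum_le_sum fun i _ => ?_
            simp only [Update.exec, Sym2.map_mk, Sym2.sup_mk]
            split_ifs
            · linarith
            · simp
        _ = ∑ i, Real.exp (θ * T i) + ((M - Real.exp (θ * T k)) + (M - Real.exp (θ * T l))) := by
            rw [Finset.sum_add_distrib, sum_ite_mem_pair hkl]
        -- `M` is symmetric in `k` and `l`, so the two copies of it regroup into one multiple of
        -- each endpoint's own exponential.
        _ = ∑ i, Real.exp (θ * T i) + ((2 * Real.exp (θ * τ) - 1) * Real.exp (θ * T k) +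
              (2 * Real.exp (θ * τ) - 1) * Real.exp (θ * T l)) := by rw [hM]; ring
        _ = ∑ i, (1 + Update.growth (m := m) θ τ (.comm ⟨s(k, l), he⟩) i) *
              Real.exp (θ * T i) := by
            rw [← sum_ite_mem_pair hkl fun i => (2 * Real.exp (θ * τ) - 1) * Real.exp (θ * T i),
              ← Finset.sum_add_distrib]
            refine Finset.sum_congr rfl fun i _ => ?_
            simp only [Update.growth]
            split_ifs <;> ring

open Classical in
theorem sum_edgeSet_ite_mem (p : PMF (Update G m)) (i : Fin n) :
    ∑ e : G.edgeSet, (if i ∈ (e : Sym2 (Fin n)) then (p (.comm e)).toReal else 0) =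
      nodeCommProb p i := by
  rw [nodeCommProb, ← Finset.sum_filter]
  symm
  refine Finset.sum_bij (fun j _ => ⟨s(i, (j : Fin n)), j.2⟩) ?_ ?_ ?_ ?_
  · simp
  · intro a _ b _ h
    exact Subtype.ext (Sym2.congr_right.1 (congrArg Subtype.val h))
  · rintro ⟨e, he⟩ h
    obtain ⟨j, rfl⟩ : i ∈ e := by simpa using h
    exact ⟨⟨j, he⟩, Finset.mem_univ _, rfl⟩
  · simp

theorem sum_growth (p : PMF (Update G m)) (θ τ : ℝ) (i : Fin n) :
    ∑ u, (p u).toReal * u.growth θ τ i =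
      (2 * Real.exp (θ * τ) - 1) * nodeCommProb p i + (Real.exp θ - 1) * nodeCompProb p i := by
  classical
  rw [sum_update, ← sum_edgeSet_ite_mem, Finset.mul_sum]
  congr 1
  · refine Finset.sum_congr rfl fun e _ => ?_
    simp only [Update.growth]
    split_ifs <;> ring
  · rw [Finset.sum_eq_single i]
    · rw [nodeCompProb, Finset.mul_sum]
      exact Finset.sum_congr rfl fun j _ => by simp [Update.growth, mul_comm]
    · intro k _ hk
      exact Finset.sum_eq_zero fun j _ => by simp [Update.growth, hk.symm]
    · simp

theorem sum_toReal (p : PMF (Update G m)) : ∑ u, (p u).toReal = 1 := by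
  rw [← ENNReal.toReal_sum fun u _ => p.apply_ne_top u, ← tsum_fintype (L := .unconditional _),
    p.tsum_coe, ENNReal.toReal_one]

/-- One random update multiplies the exponential potential by at most
`1 + (2 exp (θ τ) - 1) r + (exp θ - 1) q` on average. -/
theorem sum_mul_expPotential_exec_le (p : PMF (Update G m)) {θ τ q r : ℝ} (hθ : 0 ≤ θ)
    (hτ : 0 ≤ τ) (hq : ∀ i, nodeCompProb p i = q) (hr : ∀ i, nodeCommProb p i ≤ r)
    (T : Fin n → ℝ) :
    ∑ u, (p u).toReal * expPotential θ (u.exec τ T) ≤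
      (1 + ((2 * Real.exp (θ * τ) - 1) * r + (Real.exp θ - 1) * q)) * expPotential θ T := by
  have h1 : (1 : ℝ) ≤ Real.exp (θ * τ) := Real.one_le_exp (mul_nonneg hθ hτ)
  calc ∑ u, (p u).toReal * expPotential θ (u.exec τ T)
      ≤ ∑ u, (p u).toReal * ∑ i, (1 + u.growth θ τ i) * Real.exp (θ * T i) := by
        gcongr with u
        exact expPotential_exec_le θ τ u T
    _ = ∑ i, (∑ u, ((p u).toReal + (p u).toReal * u.growth θ τ i)) * Real.exp (θ * T i) := by
        simp_rw [Finset.mul_sum, Finset.sum_mul]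
        rw [Finset.sum_comm]
        refine Finset.sum_congr rfl fun i _ => Finset.sum_congr rfl fun u _ => by ring
    _ ≤ ∑ i, (1 + ((2 * Real.exp (θ * τ) - 1) * r + (Real.exp θ - 1) * q)) *
          Real.exp (θ * T i) := by
        gcongr with i
        rw [Finset.sum_add_distrib, sum_toReal, sum_growth, hq]
        have := mul_le_mul_of_nonneg_left (hr i) (by linarith : 0 ≤ 2 * Real.exp (θ * τ) - 1)
        linarith
    _ = _ := by rw [expPotential, Finset.mul_sum]

/-! ### Independence of the past and the next update -/

theorem nodeTime_congr (τ : ℝ) {σ σ' : ℕ → Update G m} {t : ℕ} (h : ∀ k < t, σ k = σ' k) :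
    nodeTime τ σ t = nodeTime τ σ' t := by
  induction t with
  | zero => rfl
  | succ t ih =>
    rw [nodeTime, nodeTime, h t t.lt_succ_self, ih fun k hk => h k (hk.trans t.lt_succ_self)]

/-- The availability times after the first `t` updates, as a function of these updates only. -/
noncomputable def nodeTimeOfPrefix (τ : ℝ) (u₀ : Update G m) (t : ℕ)
    (v : Finset.range t → Update G m) : Fin n → ℝ :=
  nodeTime τ (fun k => if h : k ∈ Finset.range t then v ⟨k, h⟩ else u₀) t

theorem nodeTimeOfPrefix_restrict (τ : ℝ) (u₀ : Update G m) (t : ℕ) (σ : ℕ → Update G m) :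
    nodeTimeOfPrefix τ u₀ t (fun k => σ k) = nodeTime τ σ t :=
  nodeTime_congr τ fun k hk => by simp [hk]

variable {Ω : Type*} [MeasurableSpace Ω] {P : Measure Ω} {p : PMF (Update G m)}
  {ξ : ℕ → Ω → Update G m}

/-- No condition on `f` is needed: the times depend on finitely many updates, which form a discrete
space. -/
theorem aemeasurable_comp_nodeTime (hξ : ∀ k, HasLaw (ξ k) p.toMeasure P) {β : Type*}
    [MeasurableSpace β] (τ : ℝ) (t : ℕ) (f : (Fin n → ℝ) → β) :
    AEMeasurable (fun ω => f (nodeTime τ (fun k => ξ k ω) t)) P := by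
  -- `u₀` only fills the schedule beyond time `t`, where its value is irrelevant.
  obtain ⟨u₀, -⟩ := p.support_nonempty
  have h : AEMeasurable (fun ω (k : Finset.range t) => ξ k ω) P :=
    aemeasurable_pi_lambda _ fun k => (hξ k).aemeasurable
  have := (Measurable.of_discrete (f := fun v => f (nodeTimeOfPrefix τ u₀ t v))).comp_aemeasurable h
  refine this.congr (ae_of_all _ fun ω => ?_)
  exact congrArg f (nodeTimeOfPrefix_restrict τ u₀ t fun k => ξ k ω)

/-- The first `t` updates being independent of the next one, averages of functions of both can be
computed by averaging over the next update first. -/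
theorem lintegral_nodeTime_succ [IsProbabilityMeasure P] (hi : iIndepFun ξ P)
    (hξ : ∀ k, HasLaw (ξ k) p.toMeasure P) (τ : ℝ) (t : ℕ) (f : (Fin n → ℝ) → ENNReal) :
    ∫⁻ ω, f (nodeTime τ (fun k => ξ k ω) (t + 1)) ∂P =
      ∫⁻ ω, ∑ u, p u * f (u.exec τ (nodeTime τ (fun k => ξ k ω) t)) ∂P := by
  obtain ⟨u₀, -⟩ := p.support_nonempty
  set X : Ω → (Finset.range t → Update G m) := fun ω k => ξ k ω
  have hXm : AEMeasurable X P := aemeasurable_pi_lambda _ fun k => (hξ k).aemeasurable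
  have hm : ∀ k, AEMeasurable (ξ k) P := fun k => (hξ k).aemeasurable
  have hind : IndepFun X (ξ t) P := by
    have := hi.indepFun_finset₀ (Finset.range t) {t} (by simp) hm
    exact this.comp measurable_id
      (measurable_pi_apply (⟨t, Finset.mem_singleton_self t⟩ : ({t} : Finset ℕ)))
  have hT : ∀ ω, nodeTime τ (fun k => ξ k ω) t = nodeTimeOfPrefix τ u₀ t (X ω) := fun ω =>
    (nodeTimeOfPrefix_restrict τ u₀ t fun k => ξ k ω).symm
  simp_rw [nodeTime, hT]
  let F : (Finset.range t → Update G m) × Update G m → ENNReal := fun x =>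
    f (x.2.exec τ (nodeTimeOfPrefix τ u₀ t x.1))
  have hF : Measurable F := .of_discrete
  calc ∫⁻ ω, F (X ω, ξ t ω) ∂P
      = ∫⁻ x, F x ∂(P.map X).prod p.toMeasure := by
        rw [← (hξ t).map_eq, ← hind.map_prod_eq_prod_map_map hXm (hm t),
          lintegral_map' hF.aemeasurable (hXm.prodMk (hm t))]
    _ = ∫⁻ ω, ∫⁻ u, F (X ω, u) ∂p.toMeasure ∂P := by
        rw [lintegral_prod _ hF.aemeasurable,
          lintegral_map' (Measurable.of_discrete).aemeasurable hXm]
    _ = _ := by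
        refine lintegral_congr fun ω => ?_
        rw [lintegral_fintype]
        refine Finset.sum_congr rfl fun u _ => ?_
        rw [p.toMeasure_apply_singleton u (measurableSet_singleton u), mul_comm]

/-! ### Moment bound and Markov's inequality -/

theorem lintegral_expPotential_nodeTime_le [IsProbabilityMeasure P] (hi : iIndepFun ξ P)
    (hξ : ∀ k, HasLaw (ξ k) p.toMeasure P) {θ τ q r : ℝ} (hθ : 0 ≤ θ) (hτ : 0 ≤ τ)
    (hq : ∀ i, nodeCompProb p i = q) (hr : ∀ i, nodeCommProb p i ≤ r) (t : ℕ) :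
    ∫⁻ ω, ENNReal.ofReal (expPotential θ (nodeTime τ (fun k => ξ k ω) t)) ∂P ≤
      ENNReal.ofReal (1 + ((2 * Real.exp (θ * τ) - 1) * r + (Real.exp θ - 1) * q)) ^ t * n := by
  induction t with
  | zero => simp [nodeTime, expPotential]
  | succ t ih =>
    rw [lintegral_nodeTime_succ hi hξ τ t fun T => ENNReal.ofReal (expPotential θ T), pow_succ',
      mul_assoc]
    refine le_trans ?_ (mul_le_mul_right ih _)
    rw [← lintegral_const_mul' _ _ ENNReal.ofReal_ne_top]
    refine lintegral_mono fun ω => ?_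
    set T := nodeTime τ (fun k => ξ k ω) t
    rw [← ENNReal.ofReal_mul' (expPotential_nonneg θ T)]
    refine le_trans (le_of_eq ?_)
      (ENNReal.ofReal_le_ofReal (sum_mul_expPotential_exec_le p hθ hτ hq hr T))
    rw [ENNReal.ofReal_sum_of_nonneg fun u _ =>
      mul_nonneg ENNReal.toReal_nonneg (expPotential_nonneg θ _)]
    refine Finset.sum_congr rfl fun u _ => ?_
    rw [ENNReal.ofReal_mul ENNReal.toReal_nonneg, ENNReal.ofReal_toReal (p.apply_ne_top u)]

theorem exp_le_expPotential_of_le_execTime (hn : 0 < n) {θ : ℝ} (hθ : 0 ≤ θ) (τ a : ℝ)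
    (σ : ℕ → Update G m) (t : ℕ) (h : a ≤ execTime τ σ t) :
    Real.exp (θ * a) ≤ expPotential θ (nodeTime τ σ t) := by
  have : Nonempty (Fin n) := ⟨⟨0, hn⟩⟩
  obtain ⟨i, hi⟩ := exists_eq_ciSup_of_finite (f := nodeTime τ σ t)
  rw [execTime, ← hi] at h
  refine le_trans ?_ (Finset.single_le_sum (f := fun i => Real.exp (θ * nodeTime τ σ t i))
    (fun _ _ => (Real.exp_pos _).le) (Finset.mem_univ i))
  gcongr

/-- If the growth rate of the exponential potential is smaller than `θ ν`, then the execution time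
of the first `t` updates is at least `ν t` with vanishing probability. -/
theorem tendsto_measure_le_execTime [IsProbabilityMeasure P] (hn : 0 < n) (hi : iIndepFun ξ P)
    (hξ : ∀ k, HasLaw (ξ k) p.toMeasure P) {θ τ q r ν : ℝ} (hθ : 0 ≤ θ) (hτ : 0 ≤ τ)
    (hq : ∀ i, nodeCompProb p i = q) (hr : ∀ i, nodeCommProb p i ≤ r)
    (hν : (2 * Real.exp (θ * τ) - 1) * r + (Real.exp θ - 1) * q < θ * ν) :
    Tendsto (fun t : ℕ => P {ω | ν * t ≤ execTime τ (fun k => ξ k ω) t}) atTop (𝓝 0) := by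
  set c := (2 * Real.exp (θ * τ) - 1) * r + (Real.exp θ - 1) * q
  have hbound : ∀ t : ℕ, P {ω | ν * t ≤ execTime τ (fun k => ξ k ω) t} ≤
      ENNReal.ofReal (Real.exp (c - θ * ν)) ^ t * n := by
    intro t
    have hM := mul_meas_ge_le_lintegral₀ (μ := P) (aemeasurable_comp_nodeTime hξ τ t
      fun T => ENNReal.ofReal (expPotential θ T)) (ENNReal.ofReal (Real.exp (θ * (ν * t))))
    have hE := lintegral_expPotential_nodeTime_le hi hξ hθ hτ hq hr t
    have hsub : P {ω | ν * t ≤ execTime τ (fun k => ξ k ω) t} ≤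
        P {ω | ENNReal.ofReal (Real.exp (θ * (ν * t))) ≤
          ENNReal.ofReal (expPotential θ (nodeTime τ (fun k => ξ k ω) t))} :=
      measure_mono fun ω hω => ENNReal.ofReal_le_ofReal
        (exp_le_expPotential_of_le_execTime hn hθ τ _ _ t hω)
    have hone : ENNReal.ofReal (Real.exp (-(θ * ν))) ^ t *
        ENNReal.ofReal (Real.exp (θ * (ν * t))) = 1 := by
      rw [← ENNReal.ofReal_pow (Real.exp_pos _).le, ← ENNReal.ofReal_mul (by positivity),
        ← Real.exp_nat_mul, ← Real.exp_add,
        show (t : ℝ) * -(θ * ν) + θ * (ν * t) = 0 by ring, Real.exp_zero, ENNReal.ofReal_one]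
    calc P {ω | ν * t ≤ execTime τ (fun k => ξ k ω) t}
        = ENNReal.ofReal (Real.exp (-(θ * ν))) ^ t * (ENNReal.ofReal (Real.exp (θ * (ν * t))) *
            P {ω | ν * t ≤ execTime τ (fun k => ξ k ω) t}) := by
          rw [← mul_assoc, hone, one_mul]
      _ ≤ ENNReal.ofReal (Real.exp (-(θ * ν))) ^ t * (ENNReal.ofReal (1 + c) ^ t * n) := by
          exact mul_le_mul_right ((mul_le_mul_right hsub _).trans (hM.trans hE)) _
      -- Uses `1 + c ≤ exp c`.
      _ ≤ ENNReal.ofReal (Real.exp (-(θ * ν))) ^ t * (ENNReal.ofReal (Real.exp c) ^ t * n) := by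
          gcongr
          linarith [Real.add_one_le_exp c]
      _ = ENNReal.ofReal (Real.exp (c - θ * ν)) ^ t * n := by
          rw [← mul_assoc, ← mul_pow, ← ENNReal.ofReal_mul (Real.exp_pos _).le, ← Real.exp_add,
            neg_add_eq_sub]
  have hlt : ENNReal.ofReal (Real.exp (c - θ * ν)) < 1 := by
    rw [ENNReal.ofReal_lt_one, Real.exp_lt_one_iff]
    linarith
  have hlim := ENNReal.Tendsto.mul_const (b := (n : ENNReal))
    (ENNReal.tendsto_pow_atTop_nhds_zero_of_lt_one hlt) (Or.inr (ENNReal.natCast_ne_top n))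
  rw [zero_mul] at hlim
  exact tendsto_of_tendsto_of_tendsto_of_le_of_le tendsto_const_nhds hlim
    (fun _ => zero_le) hbound

theorem nodeCompProb_nonneg (p : PMF (Update G m)) (i : Fin n) : 0 ≤ nodeCompProb p i :=
  Finset.sum_nonneg fun _ _ => ENNReal.toReal_nonneg

theorem nodeCommProb_nonneg (p : PMF (Update G m)) (i : Fin n) : 0 ≤ nodeCommProb p i :=
  Finset.sum_nonneg fun _ _ => ENNReal.toReal_nonneg

/-- Some node is involved in some update with positive probability. -/
theorem exists_pos_prob (p : PMF (Update G m)) :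
    ∃ i, 0 < nodeCompProb p i ∨ 0 < nodeCommProb p i := by
  classical
  obtain ⟨u, hu⟩ := p.support_nonempty
  have hpos : 0 < (p u).toReal :=
    ENNReal.toReal_pos ((p.mem_support_iff u).1 hu) (p.apply_ne_top u)
  cases u with
  | comp i j =>
    exact ⟨i, Or.inl (hpos.trans_le (Finset.single_le_sum
      (f := fun j => (p (.comp i j)).toReal) (fun _ _ => ENNReal.toReal_nonneg)
      (Finset.mem_univ j)))⟩
  | comm e =>
    obtain ⟨e, he⟩ := e
    induction e with
    | _ k l =>
      refine ⟨k, Or.inr ?_⟩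
      rw [nodeCommProb]
      exact hpos.trans_le (Finset.single_le_sum
        (f := fun j : G.neighborSet k => (p (.comm ⟨s(k, (j : Fin n)), j.2⟩)).toReal)
        (fun _ _ => ENNReal.toReal_nonneg) (Finset.mem_univ (⟨l, he⟩ : G.neighborSet k)))

end

/-! ### Choice of the exponent and of the constant -/

/-- By convexity, `exp` lies below its chord on `[0, 1]`. -/
theorem exp_sub_one_le_mul {x : ℝ} (h0 : 0 ≤ x) (h1 : x ≤ 1) :
    Real.exp x - 1 ≤ x * (Real.exp 1 - 1) := by
  have := convexOn_exp.2 (Set.mem_univ 0) (Set.mem_univ 1) (sub_nonneg.2 h1) h0 (by ring)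
  simp only [smul_eq_mul, mul_zero, mul_one, zero_add, Real.exp_zero] at this
  linarith

/-- A suitable exponent makes the growth rate of the exponential potential small enough. -/
theorem exists_exponent {q r τ : ℝ} (hq : 0 ≤ q) (hr : 0 ≤ r) (hτ : 0 ≤ τ) (hpos : 0 < q ∨ 0 < r)
    (h : r < q ∨ 1 < τ) :
    ∃ θ : ℝ, 0 ≤ θ ∧
      (2 * Real.exp (θ * τ) - 1) * r + (Real.exp θ - 1) * q < θ * (5 * (q + τ * r)) := by
  have he : Real.exp 1 < 2.7182818286 := Real.exp_one_lt_d9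
  rcases lt_or_ge 1 τ with hτ1 | hτ1
  · have hτ0 : 0 < τ := by linarith
    -- Now `θ τ = 1`: the coefficient of `r` is `2e - 1 < 5`, and that of `τ⁻¹ * q` is at most `e -
    -- 1 < 5`.
    refine ⟨τ⁻¹, by positivity, ?_⟩
    rw [inv_mul_cancel₀ hτ0.ne',
      show τ⁻¹ * (5 * (q + τ * r)) = 5 * (τ⁻¹ * q) + 5 * r by field_simp]
    have h1 := mul_le_mul_of_nonneg_right
      (exp_sub_one_le_mul (inv_nonneg.2 hτ) (inv_le_one_of_one_le₀ hτ1.le)) hq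
    have hq' : 0 ≤ τ⁻¹ * q := by positivity
    have hpos' : 0 < τ⁻¹ * q ∨ 0 < r := hpos.imp (fun h => by positivity) id
    rcases hpos' with h | h <;> nlinarith
  · have hrq : r < q := h.resolve_right hτ1.not_gt
    -- The chord bound gives `c ≤ r + 2(e - 1) τ r + (e - 1) q`. The lone `r`, which does not shrink
    -- with `τ`, is absorbed by `r < q`.
    refine ⟨1, zero_le_one, ?_⟩
    have h1 := mul_le_mul_of_nonneg_right (exp_sub_one_le_mul hτ hτ1) hr
    have h2 : 0 ≤ τ * r := by positivity
    rw [one_mul]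
    nlinarith

theorem theorem4 :
    ∃ C : ℝ, C < 24 ∧
      ∀ (n : ℕ) (_ : 0 < n) (G : SimpleGraph (Fin n)) (m : Fin n → ℕ)
        (p : PMF (Update G m)) (pcomp τ : ℝ) (_ : 0 ≤ τ)
        (_ : ∀ i, nodeCompProb p i = pcomp / n)
        (_ : pMaxComm p < pcomp ∨ 1 < τ)
        (Ω : Type*) (_ : MeasurableSpace Ω) (P : Measure Ω) (_ : IsProbabilityMeasure P)
        -- the random schedule: independent updates drawn with the probabilities `p`
        (ξ : ℕ → Ω → Update G m) (_ : iIndepFun ξ P) (_ : ∀ k, HasLaw (ξ k) p.toMeasure P),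
        Tendsto
          (fun t : ℕ =>
            P {ω | (n : ℝ)⁻¹ * C * (pcomp + τ * pMaxComm p) * t ≤ execTime τ (fun k => ξ k ω) t})
          atTop (𝓝 0) := by
  refine ⟨5, by norm_num, ?_⟩
  intro n hn G m p pcomp τ hτ hcomp hcase Ω _ P _ ξ hi hξ
  have hn' : (0 : ℝ) < n := Nat.cast_pos.2 hn
  have hr : ∀ i, nodeCommProb p i ≤ ⨆ i, nodeCommProb p i :=
    fun i => le_ciSup (Set.finite_range _).bddAbove i
  have hr0 : 0 ≤ ⨆ i, nodeCommProb p i := (nodeCommProb_nonneg p ⟨0, hn⟩).trans (hr _)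
  have hq0 : 0 ≤ pcomp / n := (nodeCompProb_nonneg p ⟨0, hn⟩).trans_eq (hcomp _)
  -- The strict inequality on the growth rate would fail if both probabilities vanished.
  have hpos : 0 < pcomp / n ∨ 0 < ⨆ i, nodeCommProb p i := by
    obtain ⟨i, h⟩ := exists_pos_prob p
    exact h.imp (fun h => h.trans_eq (hcomp i)) fun h => h.trans_le (hr i)
  have hcase' : (⨆ i, nodeCommProb p i) < pcomp / n ∨ 1 < τ := by
    refine hcase.imp_left fun h => ?_
    rwa [lt_div_iff₀' hn']
  obtain ⟨θ, hθ, h⟩ := exists_exponent hq0 hr0 hτ hpos hcase'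
  have hν : (n : ℝ)⁻¹ * 5 * (pcomp + τ * pMaxComm p) =
      5 * (pcomp / n + τ * ⨆ i, nodeCommProb p i) := by
    rw [pMaxComm]
    field_simp
  rw [hν]
  exact tendsto_measure_le_execTime hn hi hξ hθ hτ hcomp hr h
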